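/- Let $\Gamma$ be a countable discrete group. A $\Gamma$-space is a compact Hausdorff space on which $\Gamma$ acts by homeomorphisms; it is minimal if every $\Gamma$-orbit is dense; a $\Gamma$-map between $\Gamma$-spaces is a continuous equivariant map. Let $L$ be the universal minimal $\Gamma$-space, i.e. a minimal left ideal of the semigroup $\beta\Gamma$ with the action of $\Gamma$ by left multiplication (up to $\Gamma$-equivariant homeomorphism), let $X$ be a minimal $\Gamma$-space, and let $Z$ be an infinite minimal $\Gamma$-space with a $\Gamma$-invariant Borel probability measure $\mu$. Let $\varphi: L\to X$ and $\theta: L\to Z$ be surjective $\Gamma$-maps, and suppose that there are a Borel measure $\nu$ on $L$ with $\theta_*\nu=\mu$ and a point $x\in X$ with $\nu(\varphi^{-1}(x))\neq 0$. A $\Gamma$-operator system is a unital self-adjoint subspace of a unital $C^*$-algebra on which $\Gamma$ acts by unital complete order automorphisms (for instance $C(X)$ and $C(L)$, with $(sf)(y)=f(s^{-1}y)$). A $\Gamma$-map between $\Gamma$-operator systems is a unital completely positive equivariant linear map, and an extension of $\mathcal V$ is a completely isometric $\Gamma$-map from $\mathcal V$ to a $\Gamma$-operator system. A $\Gamma$-operator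 system $\mathcal U$ is $\Gamma$-injective if, for every extension $\iota:\mathcal V\to\mathcal W$, every $\Gamma$-map $\phi:\mathcal V\to\mathcal U$ has the form $\phi=\psi\iota$ for some $\Gamma$-map $\psi:\mathcal W\to\mathcal U$. The $\Gamma$-injective envelope $I_\Gamma(\mathcal V)$ is a $\Gamma$-injective extension $(\mathcal I,\kappa)$ of $\mathcal V$ such that $\mathcal I_1=\mathcal I$ for every $\Gamma$-injective $\Gamma$-operator system $\mathcal I_1$ with $\kappa(\mathcal V)\subseteq\mathcal I_1\subseteq\mathcal I$. Then $I_\Gamma(C(X))\not\cong C(L)$: there is no equivariant linear bijection from $I_\Gamma(C(X))$ onto $C(L)$ that is unital and completely positive in both directions (equivalently, no $\Gamma$-equivariant $*$-isomorphism of $C^*$-algebras). -/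

import Mathlib

universe u

open scoped ComplexOrder

namespace GammaBoundary

/-! ### `Γ`-spaces and the universal minimal `Γ`-space

A `Γ`-space is a compact Hausdorff space with an action of the discrete group `Γ` by
homeomorphisms, i.e. `[TopologicalSpace X] [CompactSpace X] [T2Space X] [MulAction Γ X]
[ContinuousConstSMul Γ X]`; it is minimal if `[MulAction.IsMinimal Γ X]`. -/

/-- A `Γ`-map between `Γ`-spaces: a continuous equivariant map. -/
structure IsSpaceMap (Γ : Type*) [Group Γ] {Y X : Type*}
    [TopologicalSpace Y] [MulAction Γ Y] [TopologicalSpace X] [MulAction Γ X]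
    (φ : Y → X) : Prop where
  continuous : Continuous φ
  map_smul : ∀ (s : Γ) (y : Y), φ (s • y) = s • φ y

section StoneCech

attribute [local instance] Ultrafilter.mul

/-- A (nonempty) left ideal of the semigroup `βΓ`, realised as the space of ultrafilters on `Γ`
with the multiplication extending that of `Γ` for which `U ↦ U * V` is continuous. -/
structure IsLeftIdeal (Γ : Type*) [Group Γ] (I : Set (Ultrafilter Γ)) : Prop where
  nonempty : I.Nonempty
  mul_mem : ∀ U V : Ultrafilter Γ, V ∈ I → U * V ∈ I

end StoneCech

/-- `L` is (a copy of) the universal minimal `Γ`-space: it is `Γ`-equivariantly homeomorphic to a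
minimal left ideal of `βΓ`, on which `s : Γ` acts by pushing ultrafilters forward along left
multiplication by `s` (that is, by multiplication by the principal ultrafilter at `s`). -/
def IsUniversalMinimal (Γ : Type*) [Group Γ] (L : Type*) [TopologicalSpace L]
    [MulAction Γ L] : Prop :=
  ∃ I : Set (Ultrafilter Γ), Minimal (IsLeftIdeal Γ) I ∧
    ∃ e : L ≃ₜ I, ∀ (s : Γ) (x : L),
      (e (s • x) : Ultrafilter Γ) = (e x : Ultrafilter Γ).map (fun t => s * t)

/-! ### Operator systems -/

/-- An operator system in the unital C⋆-algebra `A`: a unital self-adjoint subspace. -/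
structure OperatorSystem (A : Type*) [CStarAlgebra A] where
  space : Submodule ℂ A
  one_mem : (1 : A) ∈ space
  star_mem : ∀ a ∈ space, star a ∈ space

section Maps

variable {A B : Type*} [CStarAlgebra A] [PartialOrder A] [StarOrderedRing A]
  [CStarAlgebra B] [PartialOrder B] [StarOrderedRing B]

/-- A unital completely positive map between operator systems. The matrix order on `Mₙ(V)` is the
one of the C⋆-algebra `Mₙ(A)`. -/
structure IsUCP {V : OperatorSystem A} {W : OperatorSystem B}
    (φ : V.space →ₗ[ℂ] W.space) : Prop where
  map_one : φ ⟨1, V.one_mem⟩ = ⟨1, W.one_mem⟩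
  map_nonneg : ∀ (n : ℕ) (M : CStarMatrix (Fin n) (Fin n) V.space),
    0 ≤ M.map (fun v => (v : A)) → 0 ≤ M.map (fun v => (φ v : B))

/-- A completely isometric map between operator systems, for the norms on `Mₙ(V)` and `Mₙ(W)`
coming from the C⋆-algebras `Mₙ(A)` and `Mₙ(B)`. -/
def IsCompletelyIsometric {V : OperatorSystem A} {W : OperatorSystem B}
    (φ : V.space →ₗ[ℂ] W.space) : Prop :=
  ∀ (n : ℕ) (M : CStarMatrix (Fin n) (Fin n) V.space),
    ‖M.map (fun v => (φ v : B))‖ = ‖M.map (fun v => (v : A))‖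

end Maps

/-- A `Γ`-operator system: an operator system with a homomorphism from `Γ` into the group of its
unital complete order automorphisms (the inverse of `act s` is `act s⁻¹`). -/
structure GammaOperatorSystem (Γ : Type*) [Group Γ] (A : Type*) [CStarAlgebra A]
    [PartialOrder A] [StarOrderedRing A] extends OperatorSystem A where
  act : Γ →* Module.End ℂ space
  act_ucp : ∀ s : Γ, IsUCP (V := toOperatorSystem) (W := toOperatorSystem) (act s)

section GammaMaps

variable {Γ : Type*} [Group Γ]
  {A B : Type*} [CStarAlgebra A] [PartialOrder A] [StarOrderedRing A]
  [CStarAlgebra B] [PartialOrder B] [StarOrderedRing B]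

/-- A `Γ`-map between `Γ`-operator systems: unital, completely positive and equivariant. -/
structure IsGammaMap (V : GammaOperatorSystem Γ A) (W : GammaOperatorSystem Γ B)
    (φ : V.space →ₗ[ℂ] W.space) : Prop where
  ucp : IsUCP (V := V.toOperatorSystem) (W := W.toOperatorSystem) φ
  map_act : ∀ (s : Γ) (v : V.space), φ (V.act s v) = W.act s (φ v)

/-- An extension of `V`: a completely isometric `Γ`-map `κ` from `V` into `W`. -/
structure IsExtension (V : GammaOperatorSystem Γ A) (W : GammaOperatorSystem Γ B)
    (κ : V.space →ₗ[ℂ] W.space) : Prop where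
  gammaMap : IsGammaMap V W κ
  isometric : IsCompletelyIsometric (V := V.toOperatorSystem) (W := W.toOperatorSystem) κ

/-- Isomorphism of `Γ`-operator systems: an equivariant linear bijection that is unital and
completely positive in both directions. -/
def IsIsomorphic (V : GammaOperatorSystem Γ A) (W : GammaOperatorSystem Γ B) : Prop :=
  ∃ e : V.space ≃ₗ[ℂ] W.space,
    IsGammaMap V W e.toLinearMap ∧ IsGammaMap W V e.symm.toLinearMap

end GammaMaps

/-- `U` is `Γ`-injective: every `Γ`-map from `V` to `U` extends along every extension `ι` of `V`. -/
def IsGammaInjective {Γ : Type u} [Group Γ] {A : Type u} [CStarAlgebra A] [PartialOrder A]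
    [StarOrderedRing A] (U : GammaOperatorSystem Γ A) : Prop :=
  ∀ (B : Type u) [CStarAlgebra B] [PartialOrder B] [StarOrderedRing B]
    (C : Type u) [CStarAlgebra C] [PartialOrder C] [StarOrderedRing C]
    (V : GammaOperatorSystem Γ B) (W : GammaOperatorSystem Γ C)
    (φ : V.space →ₗ[ℂ] U.space) (ι : V.space →ₗ[ℂ] W.space),
    IsGammaMap V U φ → IsExtension V W ι →
      ∃ ψ : W.space →ₗ[ℂ] U.space, IsGammaMap W U ψ ∧ ψ ∘ₗ ι = φ

/-- `(I, κ)` is a `Γ`-injective envelope of `V`: it is a `Γ`-injective extension of `V`, and the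
only `Γ`-injective `Γ`-operator system `J` with `κ(V) ⊆ J ⊆ I` is `J = I`. -/
structure IsGammaInjectiveEnvelope {Γ : Type u} [Group Γ]
    {A : Type u} [CStarAlgebra A] [PartialOrder A] [StarOrderedRing A]
    {B : Type u} [CStarAlgebra B] [PartialOrder B] [StarOrderedRing B]
    (V : GammaOperatorSystem Γ A) (I : GammaOperatorSystem Γ B)
    (κ : V.space →ₗ[ℂ] I.space) : Prop where
  injective : IsGammaInjective I
  extension : IsExtension V I κ
  minimal : ∀ J : GammaOperatorSystem Γ B, J.space ≤ I.space →
    (∀ (s : Γ) (b : B) (hJ : b ∈ J.space) (hI : b ∈ I.space),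
      (J.act s ⟨b, hJ⟩ : B) = I.act s ⟨b, hI⟩) →
    (∀ v : V.space, (κ v : B) ∈ J.space) →
    IsGammaInjective J → J.space = I.space

/-- The `Γ`-operator system (indeed `Γ`-C⋆-algebra) `C(X)` of a `Γ`-space `X`, with the action
`(s f)(x) = f(s⁻¹ x)`. -/
noncomputable def continuousFunctions (Γ : Type*) [Group Γ] (X : Type*) [TopologicalSpace X]
    [CompactSpace X] [MulAction Γ X] [ContinuousConstSMul Γ X] :
    GammaOperatorSystem Γ C(X, ℂ) where
  space := ⊤
  one_mem := Submodule.mem_top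
  star_mem := fun _ _ => Submodule.mem_top
  act :=
    { toFun := fun s =>
        { toFun := fun f =>
            ⟨(f : C(X, ℂ)).comp ⟨fun x => s⁻¹ • x, continuous_const_smul s⁻¹⟩,
              Submodule.mem_top⟩
          map_add' := fun _ _ => rfl
          map_smul' := fun _ _ => rfl }
      map_one' := by
        ext f x
        simp
      map_mul' := by
        intro s t
        ext f x
        simp [mul_smul] }
  act_ucp := fun s =>
    { map_one := rfl
      map_nonneg := fun n M hM =>
        CompletelyPositiveMapClass.map_cstarMatrix_nonneg'
          (ContinuousMap.compStarAlgHom' ℂ ℂ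
            (⟨fun x => s⁻¹ • x, continuous_const_smul s⁻¹⟩ : C(X, X))) n _ hM }

end GammaBoundary

/-!
Suppose that the `Γ`-injective envelope of `C(X)` is isomorphic to `C(L)`, and let
`κ : C(X) → C(L)` be the resulting embedding. A unital positive equivariant operator
`C(X) → C(L)` is the same thing as a continuous equivariant family of states of `C(X)` indexed
by `L` (an equivariant *kernel*); complete positivity costs nothing because the algebras are
commutative (`isGammaMap_systemMap`). Write `k` for the kernel of `κ`.

*Rigidity.* A retraction of the envelope that fixes `C(X)` has a `Γ`-injective range, so by
minimality it is the identity (`IsGammaInjectiveEnvelope.eq_self_of_idempotent`). Since `L` is a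
retract of `βΓ`, every state `τ` of `C(L)` generates the equivariant kernel
`p ↦ lim_{s → p} s • τ`, and in this way the states of `C(L)` form a compact semigroup with
one-sided continuous multiplication. If `T` fixes `κ`, then the left ideal generated by the average
of `T` and the identity contains an idempotent, which must be the identity; as point masses are
extreme states, `T` is the identity (`IsUltrafilterRetract.rigid`).

*Contraction of fibers.* Since `κ` is isometric, every point mass of `X` is a value of `k`
(`exists_eq_eval_of_attains`). Rigidity then gives a `Γ`-automorphism of `L` carrying `k` to `φ`.
Composed with it, the kernel generated by any state `m` of `C(L)` that lives on a fiber of `φ`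
becomes one that fixes `κ`, so some element of `βΓ` sends `m` to a point mass
(`IsUltrafilterRetract.exists_ultraSMul_eq_eval`).

*Contradiction.* Let `m` be the normalised restriction of `ν` to the fiber over `x`. The image of
`m` in `Z` is dominated by a multiple of the invariant measure `μ`; this passes to limits of
translates, so a point mass on `Z` is dominated by a multiple of `μ` (`apply_le_mul_integral`). By
invariance, all points of its orbit have mass bounded below, although the orbit is infinite
(`not_forall_apply_le_mul_integral`).
-/

namespace GammaBoundary

open Filter Topology MeasureTheory

/-! ### The action of `βΓ` on compact `Γ`-spaces -/

section Limits

variable {Γ : Type*} [Group Γ] {Y W : Type*} [TopologicalSpace Y] [MulAction Γ Y]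
  [TopologicalSpace W] [MulAction Γ W]

/-- The action of `βΓ` on a compact Hausdorff `Γ`-space: `U` sends `y` to `lim_{s → U} s • y`. -/
noncomputable def ultraSMul (U : Ultrafilter Γ) (y : Y) : Y :=
  Ultrafilter.extend (fun s : Γ => s • y) U

theorem tendsto_ultraSMul [CompactSpace Y] [T2Space Y] (U : Ultrafilter Γ) (y : Y) :
    Tendsto (fun s : Γ => s • y) U (𝓝 (ultraSMul U y)) :=
  ultrafilter_extend_eq_iff.1 rfl

theorem ultraSMul_eq_of_tendsto [CompactSpace Y] [T2Space Y] {U : Ultrafilter Γ} {y z : Y}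
    (h : Tendsto (fun s : Γ => s • y) U (𝓝 z)) : ultraSMul U y = z :=
  tendsto_nhds_unique (tendsto_ultraSMul U y) h

theorem continuous_ultraSMul [CompactSpace Y] [T2Space Y] (y : Y) :
    Continuous fun U : Ultrafilter Γ => ultraSMul U y :=
  continuous_ultrafilter_extend _

theorem ultraSMul_map [CompactSpace Y] [T2Space Y] [ContinuousConstSMul Γ Y] (s : Γ)
    (U : Ultrafilter Γ) (y : Y) : ultraSMul (U.map (fun t => s * t)) y = s • ultraSMul U y := by
  apply ultraSMul_eq_of_tendsto
  rw [Ultrafilter.coe_map, tendsto_map'_iff]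
  have := (tendsto_ultraSMul U y).const_smul s
  simpa [Function.comp_def, mul_smul] using this

theorem IsSpaceMap.map_ultraSMul [CompactSpace Y] [T2Space Y] [CompactSpace W] [T2Space W]
    {g : Y → W} (hg : IsSpaceMap Γ g) (U : Ultrafilter Γ) (y : Y) :
    g (ultraSMul U y) = ultraSMul U (g y) := by
  symm
  apply ultraSMul_eq_of_tendsto
  have := (hg.continuous.tendsto _).comp (tendsto_ultraSMul U y)
  simpa [Function.comp_def, hg.map_smul] using this

theorem IsSpaceMap.comp {V : Type*} [TopologicalSpace V] [MulAction Γ V] {h : W → V} {g : Y → W}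
    (hh : IsSpaceMap Γ h) (hg : IsSpaceMap Γ g) : IsSpaceMap Γ (fun y => h (g y)) :=
  ⟨hh.continuous.comp hg.continuous, fun s y => by rw [hg.map_smul, hh.map_smul]⟩

/-- The range of a `Γ`-map is closed and invariant, so it is everything if the target is minimal. -/
theorem IsSpaceMap.surjective [CompactSpace Y] [T2Space W] [Nonempty Y] [MulAction.IsMinimal Γ W]
    {g : Y → W} (hg : IsSpaceMap Γ g) : Function.Surjective g := by
  rw [← Set.range_eq_univ]
  refine (eq_empty_or_univ_of_smul_invariant_closed Γ
    (isCompact_range hg.continuous).isClosed ?_).resolve_left (Set.range_nonempty g).ne_empty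
  rintro c _ ⟨_, ⟨y, rfl⟩, rfl⟩
  exact ⟨c • y, hg.map_smul c y⟩

end Limits

/-! ### The universal minimal `Γ`-space as a retract of `βΓ` -/

section Universal

variable {Γ : Type*} [Group Γ] {L Y : Type*} [TopologicalSpace L] [MulAction Γ L]
  [TopologicalSpace Y] [MulAction Γ Y]

/-- A presentation of `L` as a retract of `βΓ`: a `Γ`-map `E : L → βΓ` and a point `u` such that
`y ↦ lim_{s → E y} s • u` is the identity of `L`. For a minimal left ideal of `βΓ`, `E` is the
inclusion and `u` an idempotent of the ideal. -/
structure IsUltrafilterRetract (E : L → Ultrafilter Γ) (u : L) : Prop where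
  continuous : Continuous E
  map_smul : ∀ (s : Γ) (y : L), E (s • y) = (E y).map (fun t => s * t)
  tendsto : ∀ y : L, Tendsto (fun s : Γ => s • u) (E y) (𝓝 y)

variable {E : L → Ultrafilter Γ} {u : L}

theorem IsUltrafilterRetract.isSpaceMap_ultraSMul [CompactSpace Y] [T2Space Y]
    [ContinuousConstSMul Γ Y] (hE : IsUltrafilterRetract E u) (w : Y) :
    IsSpaceMap Γ (fun p : L => ultraSMul (E p) w) :=
  ⟨(continuous_ultraSMul w).comp hE.continuous, fun s y => by rw [hE.map_smul, ultraSMul_map]⟩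

theorem IsUltrafilterRetract.apply_eq [CompactSpace Y] [T2Space Y]
    [CompactSpace L] [T2Space L] (hE : IsUltrafilterRetract E u) {g : L → Y}
    (hg : IsSpaceMap Γ g) (p : L) : g p = ultraSMul (E p) (g u) := by
  rw [← hg.map_ultraSMul, ultraSMul_eq_of_tendsto (hE.tendsto p)]

section StoneCech

attribute [local instance] Ultrafilter.semigroup

theorem ultrafilter_pure_mul (s : Γ) (U : Ultrafilter Γ) :
    (pure s : Ultrafilter Γ) * U = U.map (fun t => s * t) := rfl

/-- A minimal left ideal of `βΓ` is the range of right multiplication by any of its elements. -/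
theorem range_mul_eq_of_minimal {I : Set (Ultrafilter Γ)} (hI : Minimal (IsLeftIdeal Γ) I)
    {V : Ultrafilter Γ} (hV : V ∈ I) : Set.range (· * V) = I := by
  refine hI.eq_of_subset ⟨⟨_, V, rfl⟩, ?_⟩ ?_
  · rintro U _ ⟨W, rfl⟩
    exact ⟨U * W, mul_assoc _ _ _⟩
  · rintro _ ⟨W, rfl⟩
    exact hI.prop.mul_mem W V hV

/-- An idempotent `u` of a minimal left ideal `I` is a right identity: every element of `I` has the
form `W * u`. Hence `lim_{s → y} s * u = y * u = y` for `y` in `I`. -/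
theorem IsUniversalMinimal.exists_retract (hL : IsUniversalMinimal Γ L) :
    ∃ (E : L → Ultrafilter Γ) (u : L), IsUltrafilterRetract E u := by
  obtain ⟨I, hI, e, he⟩ := hL
  obtain ⟨V, hV⟩ := hI.prop.nonempty
  obtain ⟨v, hv, hvv⟩ := exists_idempotent_in_compact_subsemigroup
    (fun r => Ultrafilter.continuous_mul_left (M := Γ) r) I ⟨V, hV⟩
    (by
      rw [← range_mul_eq_of_minimal hI hV]
      exact isCompact_range (Ultrafilter.continuous_mul_left V))
    (fun x _ y hy => hI.prop.mul_mem x y hy)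
  refine ⟨fun y => (e y : Ultrafilter Γ), e.symm ⟨v, hv⟩,
    continuous_subtype_val.comp e.continuous, he, fun y => ?_⟩
  have hy : (e y : Ultrafilter Γ) * v = e y := by
    obtain ⟨W, hW⟩ : (e y : Ultrafilter Γ) ∈ Set.range (· * v) := by
      rw [range_mul_eq_of_minimal hI hv]; exact (e y).2
    rw [← hW]
    simp only [mul_assoc, hvv]
  rw [e.isInducing.tendsto_nhds_iff, Topology.IsInducing.subtypeVal.tendsto_nhds_iff]
  have h := ((Ultrafilter.continuous_mul_left v).tendsto _).comp
    (Ultrafilter.tendsto_pure_self (e y : Ultrafilter Γ))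
  simp only [hy] at h
  refine h.congr fun s => ?_
  simp [he, ultrafilter_pure_mul]

theorem IsUniversalMinimal.isMinimal (hL : IsUniversalMinimal Γ L) : MulAction.IsMinimal Γ L := by
  obtain ⟨I, hI, e, he⟩ := hL
  refine ⟨fun y z => ?_⟩
  obtain ⟨W, hW⟩ : (e z : Ultrafilter Γ) ∈ Set.range (· * (e y : Ultrafilter Γ)) := by
    rw [range_mul_eq_of_minimal hI (e y).2]; exact (e z).2
  have h := ((Ultrafilter.continuous_mul_left (e y : Ultrafilter Γ)).tendsto _).comp
    (Ultrafilter.tendsto_pure_self W)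
  have h' : Tendsto (fun s : Γ => s • y) W (𝓝 z) := by
    rw [e.isInducing.tendsto_nhds_iff, Topology.IsInducing.subtypeVal.tendsto_nhds_iff]
    simp only [hW] at h
    refine h.congr fun s => ?_
    simp [he, ultrafilter_pure_mul]
  exact mem_closure_of_tendsto h' (Eventually.of_forall fun s => ⟨s, rfl⟩)

end StoneCech

end Universal

/-! ### States of `C(Y)` -/

section States

variable {Y : Type*} [TopologicalSpace Y]

/-- The states of `C(Y)`: the positive unital linear functionals. -/
structure StateSpace (Y : Type*) [TopologicalSpace Y] where
  toFun : C(Y, ℂ) → ℂ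
  map_add : ∀ f g, toFun (f + g) = toFun f + toFun g
  map_smul : ∀ (c : ℂ) f, toFun (c • f) = c * toFun f
  map_one : toFun 1 = 1
  map_nonneg : ∀ f, 0 ≤ f → 0 ≤ toFun f

namespace StateSpace

noncomputable section

instance : CoeFun (StateSpace Y) fun _ => C(Y, ℂ) → ℂ := ⟨StateSpace.toFun⟩

/-- The topology of pointwise convergence on `C(Y)`, that is, the weak-* topology. -/
instance : TopologicalSpace (StateSpace Y) := .induced StateSpace.toFun inferInstance

@[ext] theorem ext {τ σ : StateSpace Y} (h : ∀ f, τ f = σ f) : τ = σ := by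
  cases τ; cases σ
  congr
  exact funext h

theorem isInducing_toFun : IsInducing (StateSpace.toFun (Y := Y)) := ⟨rfl⟩

instance : T2Space (StateSpace Y) :=
  T2Space.of_injective_continuous (f := StateSpace.toFun) (fun _ _ h => ext (congrFun h))
    isInducing_toFun.continuous

theorem continuous_apply (f : C(Y, ℂ)) : Continuous fun τ : StateSpace Y => τ f :=
  (_root_.continuous_apply f).comp isInducing_toFun.continuous

theorem continuous_of_apply {W : Type*} [TopologicalSpace W] {g : W → StateSpace Y}
    (h : ∀ f, Continuous fun w => g w f) : Continuous g :=
  isInducing_toFun.continuous_iff.2 (continuous_pi h)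

variable (τ : StateSpace Y)

theorem map_sub (f g : C(Y, ℂ)) : τ (f - g) = τ f - τ g := by
  rw [sub_eq_add_neg, τ.map_add, ← neg_one_smul ℂ g, τ.map_smul]; ring

/-- A real-valued continuous function as an element of `C(Y, ℂ)`. -/
def _root_.GammaBoundary.ofRealC (a : C(Y, ℝ)) : C(Y, ℂ) :=
  ⟨fun y => (a y : ℂ), Complex.continuous_ofReal.comp a.continuous⟩

theorem _root_.GammaBoundary.ofRealC_nonneg {a : C(Y, ℝ)} (ha : ∀ y, 0 ≤ a y) : 0 ≤ ofRealC a :=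
  ContinuousMap.le_def.2 fun y => by simpa [ofRealC] using ha y

theorem norm_le_of_im_eq_zero {h : C(Y, ℂ)} {a : C(Y, ℝ)} (hh : ∀ y, (h y).im = 0)
    (ha : ∀ y, ‖h y‖ ≤ a y) : ‖τ h‖ ≤ (τ (ofRealC a)).re := by
  have hre : ∀ y, |(h y).re| ≤ a y := fun y => (Complex.abs_re_le_norm _).trans (ha y)
  have h1 : 0 ≤ τ (ofRealC a - h) := τ.map_nonneg _ <| ContinuousMap.le_def.2 fun y => by
    have := (abs_le.1 (hre y)).2
    simp [ofRealC, Complex.le_def, hh y, this]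
  have h2 : 0 ≤ τ (ofRealC a + h) := τ.map_nonneg _ <| ContinuousMap.le_def.2 fun y => by
    have := (abs_le.1 (hre y)).1
    simp [ofRealC, Complex.le_def, hh y]; linarith
  rw [τ.map_sub] at h1
  rw [τ.map_add] at h2
  simp only [Complex.le_def, Complex.zero_re, Complex.zero_im, Complex.sub_re, Complex.sub_im,
    Complex.add_re, Complex.add_im] at h1 h2
  have him : (τ h).im = 0 := by linarith [h1.2, h2.2]
  have : τ h = ((τ h).re : ℂ) := Complex.ext rfl (by simpa using him)
  rw [this, Complex.norm_real, Real.norm_eq_abs, abs_le]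
  constructor <;> linarith [h1.1, h2.1]

/-- Domination by the absolute value. The constant `2` (in place of the sharp `1`) comes from
estimating real and imaginary parts separately. -/
theorem norm_le_two_mul {f : C(Y, ℂ)} {a : C(Y, ℝ)} (ha : ∀ y, ‖f y‖ ≤ a y) :
    ‖τ f‖ ≤ 2 * (τ (ofRealC a)).re := by
  let p : C(Y, ℝ) := ⟨fun y => (f y).re, by fun_prop⟩
  let q : C(Y, ℝ) := ⟨fun y => (f y).im, by fun_prop⟩
  have hf : f = ofRealC p + Complex.I • ofRealC q := by
    ext y
    simp [p, q, ofRealC, mul_comm Complex.I]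
  have h1 : ‖τ (ofRealC p)‖ ≤ (τ (ofRealC a)).re := τ.norm_le_of_im_eq_zero (by simp [ofRealC])
    fun y => by simpa [ofRealC, p] using (Complex.abs_re_le_norm _).trans (ha y)
  have h2 : ‖τ (ofRealC q)‖ ≤ (τ (ofRealC a)).re := τ.norm_le_of_im_eq_zero (by simp [ofRealC])
    fun y => by simpa [ofRealC, q] using (Complex.abs_im_le_norm _).trans (ha y)
  calc ‖τ f‖ = ‖τ (ofRealC p) + Complex.I * τ (ofRealC q)‖ := by
        rw [← τ.map_smul, ← τ.map_add, ← hf]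
    _ ≤ ‖τ (ofRealC p)‖ + ‖Complex.I * τ (ofRealC q)‖ := norm_add_le _ _
    _ ≤ _ := by rw [norm_mul, Complex.norm_I]; linarith

instance [CompactSpace Y] : CompactSpace (StateSpace Y) := by
  have hrange : Set.range (StateSpace.toFun (Y := Y)) =
      {τ : C(Y, ℂ) → ℂ | (∀ f g, τ (f + g) = τ f + τ g) ∧ (∀ (c : ℂ) f, τ (c • f) = c * τ f) ∧
        τ 1 = 1 ∧ ∀ f, 0 ≤ f → 0 ≤ τ f} := by
    ext τ
    refine ⟨?_, fun ⟨h1, h2, h3, h4⟩ => ⟨⟨τ, h1, h2, h3, h4⟩, rfl⟩⟩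
    rintro ⟨σ, rfl⟩
    exact ⟨σ.map_add, σ.map_smul, σ.map_one, σ.map_nonneg⟩
  rw [← isCompact_univ_iff, isInducing_toFun.isCompact_iff, Set.image_univ]
  refine IsCompact.of_isClosed_subset
    (isCompact_univ_pi fun f : C(Y, ℂ) => isCompact_closedBall (0 : ℂ) (2 * ‖f‖)) ?_ ?_
  · rw [hrange]
    have hc : ∀ f : C(Y, ℂ), Continuous fun τ : C(Y, ℂ) → ℂ => τ f := _root_.continuous_apply
    have := Complex.orderClosedTopology
    simp only [Set.ofPred_and, Set.ofPred_forall]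
    refine .inter ?_ (.inter ?_ (.inter ?_ ?_))
    · exact isClosed_iInter fun f => isClosed_iInter fun g => isClosed_eq (hc _) ((hc _).add (hc _))
    · exact isClosed_iInter fun c => isClosed_iInter fun f =>
        isClosed_eq (hc _) (continuous_const.mul (hc _))
    · exact isClosed_eq (hc _) continuous_const
    · exact isClosed_iInter fun f => isClosed_iInter fun _ => isClosed_le continuous_const (hc _)
  · rintro _ ⟨τ, rfl⟩ f _
    have := τ.norm_le_two_mul (f := f) (a := .const Y ‖f‖) fun y => f.norm_coe_le_norm y
    have h1 : ofRealC (.const Y ‖f‖) = (‖f‖ : ℂ) • (1 : C(Y, ℂ)) := by ext; simp [ofRealC]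
    rw [h1, τ.map_smul, τ.map_one] at this
    simpa using this

/-- The point evaluation at `y`. -/
def eval (y : Y) : StateSpace Y :=
  ⟨fun f => f y, fun _ _ => rfl, fun _ _ => rfl, rfl, fun _ hf => ContinuousMap.le_def.1 hf y⟩

@[simp] theorem eval_apply (y : Y) (f : C(Y, ℂ)) : eval y f = f y := rfl

theorem eval_injective [CompactSpace Y] [T2Space Y] : Function.Injective (eval (Y := Y)) := by
  intro y z h
  by_contra hne
  obtain ⟨f, hf0, hf1, -⟩ := exists_continuous_zero_one_of_isClosed (isClosed_singleton (x := y))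
    (isClosed_singleton (x := z)) (Set.disjoint_singleton.2 hne)
  have := congrArg (fun τ : StateSpace Y => τ (ofRealC f)) h
  have h0 : f y = 0 := hf0 rfl
  have h1 : f z = 1 := hf1 rfl
  simp [ofRealC, h0, h1] at this

/-- A state that vanishes on the nonnegative functions vanishing at `y` is the evaluation at `y`. -/
theorem eq_eval {y : Y} (h : ∀ f : C(Y, ℂ), 0 ≤ f → f y = 0 → τ f = 0) : τ = eval y := by
  ext f
  have h0 : τ (f - f y • (1 : C(Y, ℂ))) = 0 := by
    set g := f - f y • (1 : C(Y, ℂ)) with hg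
    let a : C(Y, ℝ) := ⟨fun z => ‖g z‖, by fun_prop⟩
    have ha : τ (ofRealC a) = 0 := h _ (ofRealC_nonneg fun z => norm_nonneg (g z)) (by
      simp [ofRealC, a, hg])
    have := τ.norm_le_two_mul (f := g) (a := a) fun z => le_rfl
    rw [ha] at this
    simpa using this
  rw [τ.map_sub, τ.map_smul, τ.map_one, mul_one, sub_eq_zero] at h0
  exact h0

end

end StateSpace

end States

/-! ### The matrix order over `C(Y)` -/

section MatrixOrder

/-- Stated for an abstract algebra, so that it applies to `CStarMatrix`, on which the functional
calculus instances behind Mathlib's version are not found by instance search. -/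
theorem nonneg_iff_exists_star_mul_self {B : Type*} [CStarAlgebra B] [PartialOrder B]
    [StarOrderedRing B] (a : B) : 0 ≤ a ↔ ∃ b, a = star b * b :=
  CStarAlgebra.nonneg_iff_eq_star_mul_self

/-- As for `nonneg_iff_exists_star_mul_self`, the abstract form is the one that applies to
`CStarMatrix`. -/
theorem nonneg_iff_real_spectrum {B : Type*} [CStarAlgebra B] [PartialOrder B]
    [StarOrderedRing B] (a : B) (ha : IsSelfAdjoint a) : 0 ≤ a ↔ ∀ r ∈ spectrum ℝ a, 0 ≤ r :=
  StarOrderedRing.nonneg_iff_spectrum_nonneg (R := ℝ) a ha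

/-- Over `ℂ`, a matrix with nonnegative quadratic form is automatically Hermitian. -/
theorem posSemidef_of_forall_dotProduct_nonneg {n : Type*} [Fintype n] [DecidableEq n]
    {M : Matrix n n ℂ} (h : ∀ c : n → ℂ, 0 ≤ star c ⬝ᵥ M.mulVec c) : M.PosSemidef := by
  rw [← Matrix.isPositive_toEuclideanLin_iff, LinearMap.isPositive_iff_complex]
  intro c
  have hc : inner ℂ (M.toEuclideanLin c) c = star (star c.ofLp ⬝ᵥ M.mulVec c.ofLp) := by
    rw [EuclideanSpace.inner_eq_star_dotProduct, Matrix.dotProduct_star, dotProduct_comm]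
    rfl
  have h0 : 0 ≤ inner ℂ (M.toEuclideanLin c) c := by
    rw [hc]; exact star_nonneg_iff.2 (h _)
  rw [Complex.le_def] at h0
  exact ⟨Complex.ext rfl h0.2, h0.1⟩

variable {Y : Type*} [TopologicalSpace Y] [CompactSpace Y] {n : ℕ}

/-- A matrix over `C(Y)` is positive if and only if its quadratic form takes nonnegative values. -/
theorem cstarMatrix_nonneg_iff (N : CStarMatrix (Fin n) (Fin n) C(Y, ℂ)) :
    0 ≤ N ↔ ∀ c : Fin n → ℂ, 0 ≤ ∑ i, ∑ j, (star (c i) * c j) • N i j := by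
  constructor
  · intro hN c
    obtain ⟨B, rfl⟩ := (nonneg_iff_exists_star_mul_self N).1 hN
    have : ∑ i, ∑ j, (star (c i) * c j) • (star B * B) i j =
        ∑ k, star (∑ i, c i • B k i) * ∑ j, c j • B k j := by
      have h1 : ∀ i j, (star (c i) * c j) • (star B * B) i j =
          ∑ k, star (c i • B k i) * (c j • B k j) := fun i j => by
        rw [CStarMatrix.mul_apply, Finset.smul_sum]
        refine Finset.sum_congr rfl fun k _ => ?_
        rw [star_smul, smul_mul_smul_comm, CStarMatrix.star_apply]
      simp_rw [h1, star_sum, Finset.sum_mul_sum]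
      rw [Finset.sum_congr rfl fun i _ => Finset.sum_comm, Finset.sum_comm]
    rw [this]
    exact Finset.sum_nonneg fun k _ => star_mul_self_nonneg _
  · intro h
    have hps : ∀ y, (Matrix.of fun i j => N i j y).PosSemidef := fun y => by
      refine posSemidef_of_forall_dotProduct_nonneg fun c => ?_
      have := ContinuousMap.le_def.1 (h c) y
      simp only [ContinuousMap.zero_apply, ContinuousMap.sum_apply, ContinuousMap.smul_apply,
        smul_eq_mul] at this
      convert this using 1
      simp only [dotProduct, Matrix.mulVec, Finset.mul_sum, Matrix.of_apply, Pi.star_apply]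
      exact Finset.sum_congr rfl fun i _ => Finset.sum_congr rfl fun j _ => by ring
    have hsa : IsSelfAdjoint N := by
      ext i j y
      have := (hps y).1.apply i j
      simpa [CStarMatrix.star_apply] using this
    rw [nonneg_iff_real_spectrum N hsa]
    intro r hr
    by_contra! hr0
    -- `r - N` is invertible, as its determinant vanishes nowhere on `Y`
    apply spectrum.mem_iff.1 hr
    rw [← MulEquiv.isUnit_map (CStarMatrix.ofMatrixRingEquiv (n := Fin n) (A := C(Y, ℂ))).symm,
      Matrix.isUnit_iff_isUnit_det, ContinuousMap.isUnit_iff_forall_ne_zero]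
    intro y
    have hpd : (Matrix.of (fun i j => N i j y) +
        (-r : ℂ) • (1 : Matrix (Fin n) (Fin n) ℂ)).PosDef :=
      Matrix.PosDef.posSemidef_add (hps y) (Matrix.PosDef.one.smul (by
        rw [← Complex.ofReal_neg]
        exact Complex.zero_lt_real.2 (neg_pos.2 hr0)))
    have hdet := hpd.det_pos.ne'
    let ev : C(Y, ℂ) →+* ℂ := (ContinuousMap.evalAlgHom ℂ ℂ y : C(Y, ℂ) →ₐ[ℂ] ℂ).toRingHom
    change ev _ ≠ 0
    rw [RingHom.map_det]
    have hneg : ev.mapMatrix ((CStarMatrix.ofMatrixRingEquiv (n := Fin n) (A := C(Y, ℂ))).symm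
        (algebraMap ℝ (CStarMatrix (Fin n) (Fin n) C(Y, ℂ)) r - N)) =
        -(Matrix.of (fun i j => N i j y) + (-r : ℂ) • (1 : Matrix (Fin n) (Fin n) ℂ)) := by
      ext i j
      change ((algebraMap ℝ (CStarMatrix (Fin n) (Fin n) C(Y, ℂ)) r) i j - N i j) y = _
      rw [Algebra.algebraMap_eq_smul_one]
      by_cases hij : i = j
      · subst hij
        simp
        ring
      · simp [hij]
    have hdet' := mul_ne_zero (pow_ne_zero (Fintype.card (Fin n)) (by norm_num : (-1 : ℂ) ≠ 0)) hdet
    rw [← Matrix.det_neg, ← hneg] at hdet'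
    exact hdet'

end MatrixOrder

/-! ### Unital completely positive maps -/

section Positivity

/-- An injective `*`-homomorphism is isometric, with the hypotheses unbundled so that it applies to
`CStarMatrix`. -/
theorem norm_map_of_injective {A B : Type*} [CStarAlgebra A] [CStarAlgebra B]
    {f : A → B} (hf : Function.Injective f)
    (map_smul : ∀ (c : ℂ) a, f (c • a) = c • f a) (map_add : ∀ a b, f (a + b) = f a + f b)
    (map_mul : ∀ a b, f (a * b) = f a * f b) (map_star : ∀ a, f (star a) = star (f a)) (a : A) :
    ‖f a‖ = ‖a‖ :=
  NonUnitalStarAlgHom.norm_map (F := A →⋆ₙₐ[ℂ] B)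
    { toFun := f
      map_smul' := map_smul
      map_zero' := by simpa using map_smul 0 0
      map_add' := map_add
      map_mul' := map_mul
      map_star' := map_star } hf a

variable {A B : Type*} [CStarAlgebra A] [PartialOrder A] [StarOrderedRing A]
  [CStarAlgebra B] [PartialOrder B] [StarOrderedRing B] {V : OperatorSystem A}
  {W : OperatorSystem B}

/-- The `1 × 1` matrix with entry `a`. -/
def oneByOne {R : Type*} (a : R) : CStarMatrix (Fin 1) (Fin 1) R := fun _ _ => a

theorem oneByOne_nonneg_iff (a : A) : 0 ≤ oneByOne a ↔ 0 ≤ a := by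
  rw [nonneg_iff_exists_star_mul_self, nonneg_iff_exists_star_mul_self]
  constructor
  · rintro ⟨b, hb⟩
    refine ⟨b 0 0, ?_⟩
    have := CStarMatrix.ext_iff.2 hb 0 0
    simpa [CStarMatrix.mul_apply, CStarMatrix.star_apply, oneByOne] using this
  · rintro ⟨b, rfl⟩
    refine ⟨oneByOne b, ?_⟩
    ext i j
    simp [CStarMatrix.mul_apply, CStarMatrix.star_apply, oneByOne]

theorem norm_oneByOne (a : A) : ‖oneByOne a‖ = ‖a‖ :=
  norm_map_of_injective (B := CStarMatrix (Fin 1) (Fin 1) A) (f := oneByOne)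
    (fun _ _ h => congrFun (congrFun h 0) 0) (fun _ _ => rfl) (fun _ _ => rfl)
    (fun a b => by ext i j; simp [CStarMatrix.mul_apply, oneByOne]) (fun _ => rfl) a

theorem IsCompletelyIsometric.norm_map {φ : V.space →ₗ[ℂ] W.space} (hφ : IsCompletelyIsometric φ)
    (v : V.space) : ‖(φ v : B)‖ = ‖(v : A)‖ := by
  have := hφ 1 (oneByOne v)
  change ‖oneByOne (φ v : B)‖ = ‖oneByOne (v : A)‖ at this
  rwa [norm_oneByOne, norm_oneByOne] at this

theorem IsUCP.nonneg {φ : V.space →ₗ[ℂ] W.space} (hφ : IsUCP φ) {v : V.space}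
    (hv : 0 ≤ (v : A)) : 0 ≤ (φ v : B) :=
  (oneByOne_nonneg_iff _).1 (hφ.map_nonneg 1 (oneByOne v) ((oneByOne_nonneg_iff _).2 hv))

theorem IsUCP.mono {φ : V.space →ₗ[ℂ] W.space} (hφ : IsUCP φ) {v w : V.space}
    (hv : (v : A) ≤ w) : (φ v : B) ≤ φ w := by
  have := hφ.nonneg (v := w - v) (by simpa using hv)
  simpa using this

/-- A self-adjoint `v` is the difference of the positive elements `v + ‖v‖` and `‖v‖`. -/
theorem IsUCP.isSelfAdjoint {φ : V.space →ₗ[ℂ] W.space} (hφ : IsUCP φ) {v : V.space}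
    (hv : IsSelfAdjoint (v : A)) : IsSelfAdjoint (φ v : B) := by
  let one : V.space := ⟨1, V.one_mem⟩
  have h1 : 0 ≤ (φ (v + (‖(v : A)‖ : ℂ) • one) : B) := hφ.nonneg (by
    have h := hv.neg_algebraMap_norm_le_self
    rw [neg_le_iff_add_nonneg] at h
    simpa [one, Algebra.algebraMap_eq_smul_one] using h)
  have h2 := h1.isSelfAdjoint
  rw [map_add, map_smul, hφ.map_one] at h2
  have h3 : IsSelfAdjoint ((‖(v : A)‖ : ℂ) • (1 : B)) :=
    IsSelfAdjoint.smul (by simp [isSelfAdjoint_iff]) (.one _)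
  simpa using h2.sub h3

theorem IsUCP.map_star {φ : V.space →ₗ[ℂ] W.space} (hφ : IsUCP φ) (v : V.space) :
    (φ ⟨star (v : A), V.star_mem _ v.2⟩ : B) = star (φ v : B) := by
  set w : V.space := ⟨star (v : A), V.star_mem _ v.2⟩ with hw
  have h1 : IsSelfAdjoint (φ (v + w) : B) := hφ.isSelfAdjoint (by
    simp [hw, isSelfAdjoint_iff, add_comm])
  have h2 : IsSelfAdjoint (φ (Complex.I • (v - w)) : B) := hφ.isSelfAdjoint (by
    simp [hw, isSelfAdjoint_iff, ← smul_neg])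
  simp only [map_add, map_smul, map_sub, Submodule.coe_add, Submodule.coe_smul, Submodule.coe_sub,
    isSelfAdjoint_iff, star_add, star_smul, star_sub] at h1 h2
  have h3 : star (φ v : B) - star (φ w : B) = -((φ v : B) - φ w) := by
    have := congrArg (fun b => Complex.I • b) h2
    simp only [smul_smul] at this
    simpa using this
  have h4 : (2 : ℂ) • star (φ v : B) = (2 : ℂ) • (φ w : B) := by
    rw [two_smul, two_smul]
    calc star (φ v : B) + star (φ v : B)
        = (star (φ v : B) + star (φ w : B)) + (star (φ v : B) - star (φ w : B)) := by abel
      _ = _ := by rw [h1, h3]; abel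
  exact (smul_right_injective B (two_ne_zero (α := ℂ)) h4).symm

end Positivity

/-! ### Kernels of states -/

namespace StateSpace

noncomputable section

section Action

variable {Γ : Type*} [Group Γ] {Y : Type*} [TopologicalSpace Y] [MulAction Γ Y]
  [ContinuousConstSMul Γ Y]

/-- The function `y ↦ f (s • y)`; it is the function `s⁻¹ f` for the action of `Γ` on `C(Y)`. -/
def _root_.GammaBoundary.translate (s : Γ) (f : C(Y, ℂ)) : C(Y, ℂ) :=
  f.comp ⟨fun y => s • y, continuous_const_smul s⟩

@[simp] theorem _root_.GammaBoundary.translate_apply (s : Γ) (f : C(Y, ℂ)) (y : Y) :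
    translate s f y = f (s • y) := rfl

instance : MulAction Γ (StateSpace Y) where
  smul s τ := ⟨fun f => τ (translate s f), fun f g => τ.map_add (translate s f) (translate s g),
    fun c f => τ.map_smul c (translate s f),
    τ.map_one, fun _ hf => τ.map_nonneg _ <| ContinuousMap.le_def.2 fun y =>
      ContinuousMap.le_def.1 hf (s • y)⟩
  one_smul τ := by
    ext f
    exact congrArg τ (by ext; simp)
  mul_smul s t τ := by
    ext f
    exact congrArg τ (by ext; simp [mul_smul])

theorem smul_apply (s : Γ) (τ : StateSpace Y) (f : C(Y, ℂ)) : (s • τ) f = τ (translate s f) := rfl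

instance : ContinuousConstSMul Γ (StateSpace Y) :=
  ⟨fun s => continuous_of_apply fun f => continuous_apply (translate s f)⟩

theorem continuous_eval : Continuous (eval (Y := Y)) := continuous_of_apply fun f => f.continuous

theorem isSpaceMap_eval : IsSpaceMap Γ (eval (Y := Y)) := ⟨continuous_eval, fun _ _ => rfl⟩

end Action

section Kernel

variable {Y X W : Type*} [TopologicalSpace Y] [TopologicalSpace X] [TopologicalSpace W]

/-- The operator `C(X) → C(Y)` defined by a continuous family of states of `C(X)` indexed by `Y`. -/
def kernelOp (K : C(Y, StateSpace X)) : C(X, ℂ) →ₗ[ℂ] C(Y, ℂ) where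
  toFun f := ⟨fun y => K y f, (continuous_apply f).comp K.continuous⟩
  map_add' f g := by ext y; exact (K y).map_add f g
  map_smul' c f := by ext y; exact (K y).map_smul c f

@[simp] theorem kernelOp_apply (K : C(Y, StateSpace X)) (f : C(X, ℂ)) (y : Y) :
    kernelOp K f y = K y f := rfl

/-- The average of the states `K y` with respect to the state `τ`. -/
def bind (K : C(Y, StateSpace X)) (τ : StateSpace Y) : StateSpace X :=
  ⟨fun f => τ (kernelOp K f), fun f g => by rw [_root_.map_add, τ.map_add],
    fun c f => by rw [_root_.map_smul, τ.map_smul],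
    by
      have : kernelOp K 1 = 1 := by ext y; exact (K y).map_one
      rw [this, τ.map_one],
    fun _ hf => τ.map_nonneg _ <| ContinuousMap.le_def.2 fun y => (K y).map_nonneg _ hf⟩

theorem bind_apply (K : C(Y, StateSpace X)) (τ : StateSpace Y) (f : C(X, ℂ)) :
    bind K τ f = τ (kernelOp K f) := rfl

@[simp] theorem bind_eval (K : C(Y, StateSpace X)) (y : Y) : bind K (eval y) = K y := rfl

theorem continuous_bind (K : C(Y, StateSpace X)) : Continuous (bind K) :=
  continuous_of_apply fun f => continuous_apply (kernelOp K f)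

/-- The composition of two kernels. -/
def kernelComp (K' : C(X, StateSpace W)) (K : C(Y, StateSpace X)) : C(Y, StateSpace W) :=
  ⟨fun y => bind K' (K y), (continuous_bind K').comp K.continuous⟩

theorem bind_bind (K' : C(X, StateSpace W)) (K : C(Y, StateSpace X)) (τ : StateSpace Y) :
    bind K' (bind K τ) = bind (kernelComp K' K) τ := rfl

/-- The kernel of point masses defined by a continuous map. -/
def dirac (g : C(Y, X)) : C(Y, StateSpace X) :=
  ⟨fun y => eval (g y), continuous_of_apply fun f => f.continuous.comp g.continuous⟩

@[simp] theorem dirac_apply (g : C(Y, X)) (y : Y) : dirac g y = eval (g y) := rfl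

theorem bind_dirac_apply (g : C(Y, X)) (τ : StateSpace Y) (f : C(X, ℂ)) :
    bind (dirac g) τ f = τ (f.comp g) := rfl

variable {Γ : Type*} [Group Γ] [MulAction Γ X] [MulAction Γ Y] [ContinuousConstSMul Γ X]
  [ContinuousConstSMul Γ Y]

theorem isSpaceMap_bind {K : C(Y, StateSpace X)} (hK : IsSpaceMap Γ K) : IsSpaceMap Γ (bind K) := by
  refine ⟨continuous_bind K, fun s τ => ?_⟩
  ext f
  rw [smul_apply, bind_apply, bind_apply, smul_apply]
  congr 1
  ext y
  simp [hK.map_smul, smul_apply]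

/-- The midpoint of two states. -/
def mid (τ σ : StateSpace Y) : StateSpace Y :=
  ⟨fun f => (1 / 2) * (τ f + σ f), fun f g => by rw [τ.map_add, σ.map_add]; ring,
    fun c f => by rw [τ.map_smul, σ.map_smul]; ring,
    by rw [τ.map_one, σ.map_one]; norm_num,
    fun _ hf => mul_nonneg (by simp) (add_nonneg (τ.map_nonneg _ hf) (σ.map_nonneg _ hf))⟩

theorem mid_apply (τ σ : StateSpace Y) (f : C(Y, ℂ)) : mid τ σ f = (1 / 2) * (τ f + σ f) := rfl

/-- Point evaluations are extreme states. -/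
theorem left_eq_eval_of_mid {τ σ : StateSpace Y} {y : Y} (h : mid τ σ = eval y) : τ = eval y := by
  refine τ.eq_eval fun f hf hfy => ?_
  have h1 : mid τ σ f = 0 := by rw [h, eval_apply, hfy]
  rw [mid_apply] at h1
  have h2 : τ f + σ f = 0 := by simpa using h1
  exact ((add_eq_zero_iff_of_nonneg (τ.map_nonneg _ hf) (σ.map_nonneg _ hf)).1 h2).1

theorem mid_comm (τ σ : StateSpace Y) : mid τ σ = mid σ τ := by
  ext f
  rw [mid_apply, mid_apply, add_comm]

end Kernel

end

end StateSpace

open StateSpace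

/-! ### Rigidity -/

section Rigidity

variable {Γ : Type*} [Group Γ] {L X : Type*} [TopologicalSpace L] [MulAction Γ L]
  [TopologicalSpace X] [MulAction Γ X] [CompactSpace X] [ContinuousConstSMul Γ X]
  {E : L → Ultrafilter Γ} {u : L}

/-- The equivariant kernel `p ↦ lim_{s → E p} s • τ`. -/
noncomputable def IsUltrafilterRetract.kernel (hE : IsUltrafilterRetract E u) (τ : StateSpace X) :
    C(L, StateSpace X) :=
  ⟨fun p => ultraSMul (E p) τ, (hE.isSpaceMap_ultraSMul τ).continuous⟩

theorem IsUltrafilterRetract.isSpaceMap_kernel (hE : IsUltrafilterRetract E u)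
    (τ : StateSpace X) : IsSpaceMap Γ (hE.kernel τ) := hE.isSpaceMap_ultraSMul τ

variable [CompactSpace L] [T2Space L] [ContinuousConstSMul Γ L]

/-- The convolution semigroup of states of `C(L)`: the product of `τ` and `σ` averages the states
`lim_{s → E p} s • σ` with respect to `τ`. It generates the composition of the kernels of `τ` and
`σ`, and it is continuous in `τ`. -/
noncomputable abbrev IsUltrafilterRetract.semigroup (hE : IsUltrafilterRetract E u) :
    Semigroup (StateSpace L) where
  mul τ σ := bind (hE.kernel σ) τ
  mul_assoc τ σ ρ := by
    change bind (hE.kernel ρ) (bind (hE.kernel σ) τ) = bind (hE.kernel (bind (hE.kernel ρ) σ)) τ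
    rw [bind_bind]
    congr 1
    ext1 p
    exact (isSpaceMap_bind (hE.isSpaceMap_kernel ρ)).map_ultraSMul (E p) σ

/-- Rigidity from minimality: if no nontrivial idempotent equivariant kernel fixes `k`, then no
nontrivial equivariant kernel fixes `k` at all. The average of the identity with a kernel `T`
fixing `k` generates a closed left ideal of the convolution semigroup of kernels fixing `k`; an
idempotent of that left ideal is trivial, and extremality of the point masses forces `T` to be
trivial. -/
theorem IsUltrafilterRetract.rigid (hE : IsUltrafilterRetract E u) {k : C(L, StateSpace X)}
    (hk : IsSpaceMap Γ k)
    (hid : ∀ P : C(L, StateSpace L), IsSpaceMap Γ P → (∀ y, bind P (P y) = P y) →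
      (∀ y, bind k (P y) = k y) → ∀ y, P y = eval y)
    (T : C(L, StateSpace L)) (hT : IsSpaceMap Γ T) (hTk : ∀ y, bind k (T y) = k y) (y : L) :
    T y = eval y := by
  -- `Q` is the average of the identity with `T`
  let Q : C(L, StateSpace L) := ⟨fun p => mid (eval p) (T p), continuous_of_apply fun f =>
    continuous_const.mul (f.continuous.add ((continuous_apply f).comp T.continuous))⟩
  have hQ : IsSpaceMap Γ Q := ⟨Q.continuous, fun s p => by
    ext f
    change (1 / 2 : ℂ) * (f (s • p) + T (s • p) f) = _
    rw [hT.map_smul]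
    rfl⟩
  have hbQ : ∀ τ, bind Q τ = mid τ (bind T τ) := fun τ => by
    ext f
    have : kernelOp Q f = (1 / 2 : ℂ) • (f + kernelOp T f) := by ext p; rfl
    rw [bind_apply, this, τ.map_smul, τ.map_add]
    rfl
  have hQk : ∀ τ, bind k (bind Q τ) = bind k τ := fun τ => by
    rw [bind_bind]
    congr 1
    ext1 p
    have h : bind k (Q p) = mid (k p) (bind k (T p)) := rfl
    change bind k (Q p) = k p
    rw [h, hTk]
    ext f
    rw [mid_apply]
    ring
  let := hE.semigroup
  have hmul : ∀ τ σ : StateSpace L, τ * σ = bind (hE.kernel σ) τ := fun _ _ => rfl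
  have hkerk : ∀ σ, bind k σ = k u → ∀ p, bind k (hE.kernel σ p) = k p := fun σ hσ p => by
    rw [hE.apply_eq hk p, ← hσ]
    exact (isSpaceMap_bind hk).map_ultraSMul _ _
  have hfix : ∀ τ σ : StateSpace L, bind k σ = k u → bind k (τ * σ) = bind k τ := fun τ σ hσ => by
    rw [hmul, bind_bind]
    congr 1
    ext1 p
    exact hkerk σ hσ p
  have hker : hE.kernel (Q u) = Q := by
    ext1 p
    exact (hE.apply_eq hQ p).symm
  have hmulQ : ∀ τ : StateSpace L, τ * Q u = bind Q τ := fun τ => by rw [hmul, hker]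
  have hQu : bind k (Q u) = k u := by
    have := hQk (eval u)
    simpa using this
  have hclosed : IsClosed {σ : StateSpace L | bind k σ = k u} :=
    isClosed_eq (continuous_bind k) continuous_const
  -- an idempotent `σ * Q u` of the left ideal generated by `Q u`
  obtain ⟨m, ⟨σ, hσ, rfl⟩, hm⟩ := exists_idempotent_in_compact_subsemigroup
    (fun r : StateSpace L => continuous_bind (hE.kernel r)) (bind Q '' {σ | bind k σ = k u})
    ⟨_, eval u, rfl, rfl⟩ (hclosed.isCompact.image (continuous_bind Q)) (by
      rintro _ ⟨σ, hσ, rfl⟩ _ ⟨ρ, hρ, rfl⟩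
      have hρ' : bind k ρ = k u := hρ
      refine ⟨σ * Q u * ρ, ?_, ?_⟩
      · change bind k _ = _
        rw [hfix _ _ hρ', hfix _ _ hQu]
        exact hσ
      · rw [← hmulQ, ← hmulQ, ← hmulQ, mul_assoc, mul_assoc])
  have hσ' : bind k σ = k u := hσ
  have htriv := hid (hE.kernel (bind Q σ)) (hE.isSpaceMap_kernel _)
    (fun p => by
      have h := (isSpaceMap_bind (hE.isSpaceMap_kernel (bind Q σ))).map_ultraSMul (E p) (bind Q σ)
      rw [← hmul (bind Q σ), hm] at h
      exact h)
    (hkerk _ (by rw [hQk, hσ'])) y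
  have h1 : bind Q (hE.kernel σ y) = eval y := by
    rw [← htriv]
    exact (isSpaceMap_bind hQ).map_ultraSMul _ _
  have h2 : hE.kernel σ y = eval y := by
    rw [hbQ] at h1
    exact left_eq_eval_of_mid h1
  rw [h2, bind_eval] at h1
  exact left_eq_eval_of_mid ((mid_comm _ _).trans h1)

/-- If `k` is rigid and its values include all point masses of `X`, then every state of `C(L)`
living on a fiber of a `Γ`-map `φ : L → X` is contracted to a point mass by some element of
`βΓ`. -/
theorem IsUltrafilterRetract.exists_ultraSMul_eq_eval [T2Space X] [MulAction.IsMinimal Γ L]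
    [MulAction.IsMinimal Γ X] (hE : IsUltrafilterRetract E u) {k : C(L, StateSpace X)}
    (hk : IsSpaceMap Γ k)
    (hrig : ∀ T : C(L, StateSpace L), IsSpaceMap Γ T → (∀ y, bind k (T y) = k y) →
      ∀ y, T y = eval y)
    (hsurj : ∀ x, ∃ p, k p = eval x) {φ : C(L, X)} (hφ : IsSpaceMap Γ φ)
    {m : StateSpace L} {x : X} (hm : bind (dirac φ) m = eval x) :
    ∃ (U : Ultrafilter Γ) (z : L), ultraSMul U m = eval z := by
  have : Nonempty L := ⟨u⟩
  -- `Γ`-endomorphisms `R b`, `R w` of `L` with `k ∘ R b = φ` and `φ ∘ R w = k`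
  let R : L → C(L, L) := fun b =>
    ⟨fun p => ultraSMul (E p) b, (hE.isSpaceMap_ultraSMul b).continuous⟩
  have hR : ∀ b, IsSpaceMap Γ (R b) := fun b => hE.isSpaceMap_ultraSMul b
  obtain ⟨b, hb⟩ := hsurj (φ u)
  have hkb : ∀ p, k (R b p) = eval (φ p) := fun p => by
    rw [hE.apply_eq hφ p, (isSpaceMap_eval (Γ := Γ)).map_ultraSMul, ← hb]
    exact hk.map_ultraSMul _ _
  obtain ⟨w, hw⟩ := (hR b).surjective u
  have hkw : ∀ p, eval (φ (R w p)) = k p := fun p => by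
    rw [hE.apply_eq hk p, ← hw, hkb]
    exact (isSpaceMap_eval.comp hφ).map_ultraSMul _ _
  have hbw : ∀ p, R b (R w p) = p := fun p => eval_injective <|
    hrig (dirac ((R b).comp (R w))) (isSpaceMap_eval.comp ((hR b).comp (hR w)))
      (fun y => by
        change k (R b (R w y)) = k y
        rw [hkb, hkw]) p
  have hwb : ∀ p, R w (R b p) = p := fun p => by
    obtain ⟨q, rfl⟩ := (hR w).surjective p
    rw [hbw]
  obtain ⟨a, ha⟩ := (hE.isSpaceMap_ultraSMul x).surjective (φ w)
  have hax : ∀ p, ultraSMul (E (R a p)) x = φ (R w p) := fun p => by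
    have h1 := (hE.isSpaceMap_ultraSMul x).map_ultraSMul (E p) a
    have h2 := hφ.map_ultraSMul (E p) w
    exact h1.trans ((congrArg _ ha).trans h2.symm)
  -- the kernel generated by `m`, moved by endomorphisms of `L` so as to fix `k`
  let T : C(L, StateSpace L) := kernelComp (dirac (R b)) ((hE.kernel m).comp (R a))
  have hRb : IsSpaceMap Γ (dirac (R b)) := isSpaceMap_eval.comp (hR b)
  have hφd : IsSpaceMap Γ (dirac φ) := isSpaceMap_eval.comp hφ
  have hT : IsSpaceMap Γ T :=
    (isSpaceMap_bind hRb).comp ((hE.isSpaceMap_kernel m).comp (hR a))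
  have hTk : ∀ y, bind k (T y) = k y := fun y => by
    have h1 : kernelComp k (dirac (R b)) = dirac φ := by ext1 p; exact hkb p
    change bind k (bind (dirac (R b)) (hE.kernel m (R a y))) = k y
    rw [bind_bind, h1, ← hkw, ← hax, (isSpaceMap_eval (Γ := Γ)).map_ultraSMul, ← hm]
    exact (isSpaceMap_bind hφd).map_ultraSMul _ _
  have hTu : bind (dirac (R b)) (ultraSMul (E (R a u)) m) = eval u := hrig T hT hTk u
  refine ⟨E (R a u), R w u, ?_⟩
  rw [← dirac_apply, ← bind_eval, ← hTu, bind_bind]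
  have h3 : kernelComp (dirac (R w)) (dirac (R b)) = dirac (.id L) := by
    ext1 p
    exact congrArg eval (hwb p)
  rw [h3]
  rfl

end Rigidity

/-! ### Kernels as `Γ`-maps of operator systems -/

section Kernels

variable {Γ : Type*} [Group Γ] {X Y : Type*} [TopologicalSpace X] [CompactSpace X]
  [MulAction Γ X] [ContinuousConstSMul Γ X] [TopologicalSpace Y] [CompactSpace Y]
  [MulAction Γ Y] [ContinuousConstSMul Γ Y]

/-- The operator defined by a kernel, as a map between the operator systems `C(X)` and `C(Y)`. -/
noncomputable def systemMap (Γ : Type*) [Group Γ] [MulAction Γ X] [ContinuousConstSMul Γ X]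
    [MulAction Γ Y] [ContinuousConstSMul Γ Y] (K : C(Y, StateSpace X)) :
    (continuousFunctions Γ X).space →ₗ[ℂ] (continuousFunctions Γ Y).space :=
  LinearMap.codRestrict ⊤ (kernelOp K ∘ₗ Submodule.subtype ⊤) fun _ => Submodule.mem_top

/-- Equivariant kernels define `Γ`-maps; complete positivity is automatic since the range is
commutative. -/
theorem isGammaMap_systemMap {K : C(Y, StateSpace X)} (hK : IsSpaceMap Γ K) :
    IsGammaMap (continuousFunctions Γ X) (continuousFunctions Γ Y) (systemMap Γ K) where
  ucp :=
    { map_one := by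
        ext y
        exact (K y).map_one
      map_nonneg := fun n M hM => by
        rw [cstarMatrix_nonneg_iff] at hM ⊢
        intro c
        have h : ∑ i, ∑ j, (star (c i) * c j) •
            (M.map fun v => (systemMap Γ K v : C(Y, ℂ))) i j =
            kernelOp K (∑ i, ∑ j, (star (c i) * c j) • (M.map fun v => (v : C(X, ℂ))) i j) := by
          simp only [map_sum, _root_.map_smul]
          rfl
        rw [h]
        exact ContinuousMap.le_def.2 fun y => (K y).map_nonneg _ (hM c) }
  map_act s v := by
    ext y
    change K y _ = K (s⁻¹ • y) _
    rw [hK.map_smul]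
    rfl

/-- The kernel of a `Γ`-map: the states obtained by composing it with the point evaluations. -/
theorem IsGammaMap.exists_kernel
    {κ : (continuousFunctions Γ X).space →ₗ[ℂ] (continuousFunctions Γ Y).space}
    (hκ : IsGammaMap (continuousFunctions Γ X) (continuousFunctions Γ Y) κ) :
    ∃ k : C(Y, StateSpace X), IsSpaceMap Γ k ∧ systemMap Γ k = κ := by
  let k : C(Y, StateSpace X) :=
    ⟨fun y =>
      { toFun := fun f => (κ ⟨f, Submodule.mem_top⟩ : C(Y, ℂ)) y
        map_add := fun f g => by
          have := κ.map_add ⟨f, Submodule.mem_top⟩ ⟨g, Submodule.mem_top⟩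
          exact congrArg (fun v : (continuousFunctions Γ Y).space => (v : C(Y, ℂ)) y) this
        map_smul := fun c f => by
          have := κ.map_smul c ⟨f, Submodule.mem_top⟩
          exact congrArg (fun v : (continuousFunctions Γ Y).space => (v : C(Y, ℂ)) y) this
        map_one := congrArg (fun v : (continuousFunctions Γ Y).space => (v : C(Y, ℂ)) y)
          hκ.ucp.map_one
        map_nonneg := fun f hf => ContinuousMap.le_def.1
          (hκ.ucp.nonneg (v := ⟨f, Submodule.mem_top⟩) hf) y },
      continuous_of_apply fun f => (κ ⟨f, Submodule.mem_top⟩ : C(Y, ℂ)).continuous⟩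
  refine ⟨k, ⟨k.continuous, fun s y => ?_⟩, rfl⟩
  ext f
  have h := hκ.map_act s⁻¹ ⟨f, Submodule.mem_top⟩
  have h' := congrArg (fun v : (continuousFunctions Γ Y).space => (v : C(Y, ℂ)) y) h
  have e1 : (continuousFunctions Γ X).act s⁻¹ ⟨f, Submodule.mem_top⟩ =
      ⟨translate s f, Submodule.mem_top⟩ := by
    ext x
    change f (s⁻¹⁻¹ • x) = _
    rw [inv_inv]
    rfl
  rw [e1] at h'
  refine Eq.trans ?_ h'.symm
  change (κ ⟨f, Submodule.mem_top⟩ : C(Y, ℂ)) (s • y) =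
    (κ ⟨f, Submodule.mem_top⟩ : C(Y, ℂ)) (s⁻¹⁻¹ • y)
  rw [inv_inv]

/-- If a positive unital operator `C(X) → C(Y)` attains the value `1` on every image of a function
`0 ≤ f ≤ 1` with `f x = 1`, then one of its states is the point evaluation at `x`: the sets where
the image of such an `f` is `1` are closed and directed, as products of such functions are again
of this form. -/
theorem exists_eq_eval_of_attains (k : C(Y, StateSpace X)) (x : X)
    (h : ∀ f : C(X, ℂ), 0 ≤ f → f ≤ 1 → f x = 1 → ∃ y, k y f = 1) : ∃ y, k y = eval x := by
  let F := {f : C(X, ℂ) // 0 ≤ f ∧ f ≤ 1 ∧ f x = 1}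
  have hmono : ∀ y (f g : C(X, ℂ)), f ≤ g → k y f ≤ k y g := fun y f g hfg => by
    have := (k y).map_nonneg (g - f) (sub_nonneg.2 hfg)
    rwa [(k y).map_sub, sub_nonneg] at this
  have hle : ∀ y (f : C(X, ℂ)), f ≤ 1 → k y f ≤ 1 := fun y f hf => by
    simpa only [(k y).map_one] using hmono y f 1 hf
  have hne : (⋂ f : F, {y | k y f.1 = 1}).Nonempty := by
    have : Nonempty F := ⟨⟨1, zero_le_one, le_rfl, rfl⟩⟩
    have hclosed : ∀ f : F, IsClosed {y | k y f.1 = 1} := fun f =>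
      isClosed_eq ((continuous_apply f.1).comp k.continuous) continuous_const
    refine IsCompact.nonempty_iInter_of_directed_nonempty_isCompact_isClosed _ ?_
      (fun f => h f.1 f.2.1 f.2.2.1 f.2.2.2) (fun f => (hclosed f).isCompact) hclosed
    intro f g
    have hfg : 0 ≤ f.1 * g.1 := mul_nonneg f.2.1 g.2.1
    have hf : f.1 * g.1 ≤ f.1 := mul_le_of_le_one_right f.2.1 g.2.2.1
    have hg : f.1 * g.1 ≤ g.1 := mul_le_of_le_one_left g.2.1 f.2.2.1
    refine ⟨⟨f.1 * g.1, hfg, hf.trans f.2.2.1, by simp [f.2.2.2, g.2.2.2]⟩, ?_, ?_⟩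
    · intro y (hy : k y (f.1 * g.1) = 1)
      exact le_antisymm (hle y _ f.2.2.1) (hy.symm.trans_le (hmono y _ _ hf))
    · intro y (hy : k y (f.1 * g.1) = 1)
      exact le_antisymm (hle y _ g.2.2.1) (hy.symm.trans_le (hmono y _ _ hg))
  obtain ⟨y, hy⟩ := hne
  refine ⟨y, (k y).eq_eval fun f hf hfx => ?_⟩
  rw [Set.mem_iInter] at hy
  -- rescale `f` so that `1 - f` belongs to the family
  let c : ℂ := ((‖f‖ + 1 : ℝ) : ℂ)⁻¹
  have hc : 0 < c := by
    have : (0 : ℝ) < ‖f‖ + 1 := by positivity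
    exact inv_pos.2 (Complex.zero_lt_real.2 this)
  have hcf : c • f ≤ 1 := ContinuousMap.le_def.2 fun z => by
    have h1 : f z = ((‖f z‖ : ℝ) : ℂ) := (RCLike.norm_of_nonneg' (ContinuousMap.le_def.1 hf z)).symm
    change c * f z ≤ 1
    rw [h1, show c = (((‖f‖ + 1)⁻¹ : ℝ) : ℂ) by simp [c], ← Complex.ofReal_mul,
      ← Complex.ofReal_one, Complex.real_le_real, inv_mul_le_one₀ (by positivity)]
    have := f.norm_coe_le_norm z
    linarith
  have hcf0 : 0 ≤ c • f := ContinuousMap.le_def.2 fun z =>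
    mul_nonneg hc.le (ContinuousMap.le_def.1 hf z)
  have h2 : k y (1 - c • f) = 1 :=
    hy ⟨1 - c • f, sub_nonneg.2 hcf, sub_le_self _ hcf0, by simp [hfx]⟩
  rw [(k y).map_sub, (k y).map_one, (k y).map_smul, sub_eq_self, mul_eq_zero] at h2
  exact h2.resolve_left hc.ne'

end Kernels

/-! ### Retractions of the `Γ`-injective envelope -/

section Envelope

variable {Γ : Type u} [Group Γ] {A : Type u} [CStarAlgebra A] [PartialOrder A] [StarOrderedRing A]
  {B : Type u} [CStarAlgebra B] [PartialOrder B] [StarOrderedRing B]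

/-- The range of a `Γ`-map from a `Γ`-operator system into itself. -/
noncomputable def rangeSystem (I : GammaOperatorSystem Γ A) (P : I.space →ₗ[ℂ] I.space)
    (hP : IsGammaMap I I P) : GammaOperatorSystem Γ A where
  space := (LinearMap.range P).map I.space.subtype
  one_mem := ⟨P ⟨1, I.one_mem⟩, ⟨_, rfl⟩, by rw [hP.ucp.map_one]; rfl⟩
  star_mem := by
    rintro _ ⟨_, ⟨v, rfl⟩, rfl⟩
    exact ⟨_, ⟨⟨star (v : A), I.star_mem _ v.2⟩, rfl⟩, hP.ucp.map_star v⟩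
  act :=
    { toFun := fun s => LinearMap.codRestrict _
        (I.space.subtype ∘ₗ I.act s ∘ₗ Submodule.inclusion (Submodule.map_subtype_le _ _)) (by
          rintro ⟨_, ⟨_, ⟨v, rfl⟩, rfl⟩⟩
          exact ⟨_, ⟨I.act s v, rfl⟩, congrArg Subtype.val (hP.map_act s v)⟩)
      map_one' := by
        ext a
        simp
      map_mul' := by
        intro s t
        ext a
        simp
        rfl }
  act_ucp s :=
    { map_one := Subtype.ext (by
        have h := congrArg Subtype.val (I.act_ucp s).map_one
        exact h)
      map_nonneg := fun n M hM => (I.act_ucp s).map_nonneg n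
        (M.map (Submodule.inclusion (Submodule.map_subtype_le _ _))) hM }

/-- A retract of a `Γ`-injective system is `Γ`-injective. -/
theorem IsGammaInjective.rangeSystem {I : GammaOperatorSystem Γ A} (hI : IsGammaInjective I)
    {P : I.space →ₗ[ℂ] I.space} (hP : IsGammaMap I I P) (hPP : ∀ v, P (P v) = P v) :
    IsGammaInjective (rangeSystem I P hP) := by
  intro B _ _ _ C _ _ _ V W φ ι hφ hι
  have hle : (GammaBoundary.rangeSystem I P hP).space ≤ I.space := Submodule.map_subtype_le _ _
  have hφ' : IsGammaMap V I (Submodule.inclusion hle ∘ₗ φ) :=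
    { ucp :=
        { map_one := Subtype.ext (by
            have h := congrArg Subtype.val hφ.ucp.map_one
            exact h)
          map_nonneg := hφ.ucp.map_nonneg }
      map_act := fun s v => Subtype.ext (by
        have h := congrArg Subtype.val (hφ.map_act s v)
        exact h) }
  obtain ⟨ψ, hψ, hψι⟩ := hI B C V W _ ι hφ' hι
  refine ⟨LinearMap.codRestrict _ (I.space.subtype ∘ₗ P ∘ₗ ψ) fun w => ⟨_, ⟨ψ w, rfl⟩, rfl⟩,
    { ucp :=
        { map_one := Subtype.ext ?_
          map_nonneg := fun n M hM =>
            hP.ucp.map_nonneg n (M.map ψ) (hψ.ucp.map_nonneg n M hM) }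
      map_act := fun s w => Subtype.ext ?_ }, ?_⟩
  · change (P (ψ ⟨1, W.one_mem⟩) : A) = 1
    rw [hψ.ucp.map_one, hP.ucp.map_one]
  · change (P (ψ (W.act s w)) : A) = I.act s (P (ψ w))
    rw [hψ.map_act, hP.map_act]
  · ext v
    change (P (ψ (ι v)) : A) = φ v
    have h1 : ψ (ι v) = Submodule.inclusion hle (φ v) := LinearMap.congr_fun hψι v
    obtain ⟨_, ⟨w, rfl⟩, hw⟩ := (φ v).2
    have h2 : Submodule.inclusion hle (φ v) = P w := Subtype.ext hw.symm
    rw [h1, h2, hPP]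
    exact hw

/-- A `Γ`-injective envelope admits no proper retraction fixing the original system. -/
theorem IsGammaInjectiveEnvelope.eq_self_of_idempotent {V : GammaOperatorSystem Γ B}
    {I : GammaOperatorSystem Γ A} {κ : V.space →ₗ[ℂ] I.space}
    (h : IsGammaInjectiveEnvelope V I κ) {P : I.space →ₗ[ℂ] I.space} (hP : IsGammaMap I I P)
    (hPP : ∀ v, P (P v) = P v) (hPκ : ∀ v, P (κ v) = κ v) (v : I.space) : P v = v := by
  have hJ := h.minimal (rangeSystem I P hP) (Submodule.map_subtype_le _ _) (fun _ _ _ _ => rfl)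
    (fun w => ⟨_, ⟨κ w, rfl⟩, congrArg Subtype.val (hPκ w)⟩) (h.injective.rangeSystem hP hPP)
  have hv : (v : A) ∈ (rangeSystem I P hP).space := by rw [hJ]; exact v.2
  obtain ⟨_, ⟨w, rfl⟩, hw⟩ := hv
  have h2 : v = P w := Subtype.ext hw.symm
  rw [h2, hPP]

theorem IsGammaMap.comp {C : Type*} [CStarAlgebra C] [PartialOrder C] [StarOrderedRing C]
    {U : GammaOperatorSystem Γ A} {V : GammaOperatorSystem Γ B} {W : GammaOperatorSystem Γ C}
    {ψ : V.space →ₗ[ℂ] W.space} {φ : U.space →ₗ[ℂ] V.space} (hψ : IsGammaMap V W ψ)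
    (hφ : IsGammaMap U V φ) : IsGammaMap U W (ψ ∘ₗ φ) where
  ucp :=
    { map_one := by
        change ψ (φ _) = _
        rw [hφ.ucp.map_one, hψ.ucp.map_one]
      map_nonneg := fun n M hM => hψ.ucp.map_nonneg n (M.map φ) (hφ.ucp.map_nonneg n M hM) }
  map_act s u := by
    change ψ (φ _) = W.act s (ψ (φ u))
    rw [hφ.map_act, hψ.map_act]

end Envelope

/-! ### Invariant measures -/

section Measure

variable {Γ : Type*} [Group Γ] {L : Type*} [TopologicalSpace L] [CompactSpace L]
  [MulAction Γ L] [ContinuousConstSMul Γ L] [MeasurableSpace L] [BorelSpace L]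
  {Z : Type*} [TopologicalSpace Z] [MulAction Γ Z]
  [ContinuousConstSMul Γ Z] [MeasurableSpace Z] [BorelSpace Z]

theorem integrable_continuousMap (ν : Measure L) [IsFiniteMeasure ν] (f : C(L, ℂ)) :
    Integrable f ν :=
  Integrable.of_bound f.continuous.measurable.aestronglyMeasurable ‖f‖
    (Eventually.of_forall f.norm_coe_le_norm)

/-- The state of `C(L)` given by the normalised restriction of `ν` to `F`. -/
noncomputable def setState (ν : Measure L) [IsFiniteMeasure ν] (F : Set L) (hF : ν F ≠ 0) :
    StateSpace L where
  toFun f := ((ν.real F)⁻¹ : ℝ) * ∫ y in F, f y ∂ν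
  map_add f g := by
    rw [← mul_add, ← integral_add (integrable_continuousMap _ f) (integrable_continuousMap _ g)]
    rfl
  map_smul c f := by
    simp only [ContinuousMap.smul_apply, smul_eq_mul, integral_const_mul]
    ring
  map_one := by
    have h : ν.real F ≠ 0 := by simpa [Measure.real, ENNReal.toReal_eq_zero_iff] using hF
    simp [h]
  map_nonneg f hf := by
    refine mul_nonneg (Complex.zero_le_real.2 (by positivity)) ?_
    have h1 : ∀ y, f y = (((f y).re : ℝ) : ℂ) := fun y => Complex.ext rfl
      (Complex.le_def.1 (ContinuousMap.le_def.1 hf y)).2.symm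
    have h2 : ∀ y, 0 ≤ (f y).re := fun y => (Complex.le_def.1 (ContinuousMap.le_def.1 hf y)).1
    rw [integral_congr_ae (Eventually.of_forall h1), integral_complex_ofReal]
    exact Complex.zero_le_real.2 (integral_nonneg h2)

theorem setState_apply (ν : Measure L) [IsFiniteMeasure ν] (F : Set L) (hF : ν F ≠ 0)
    (f : C(L, ℂ)) : setState ν F hF f = ((ν.real F)⁻¹ : ℝ) * ∫ y in F, f y ∂ν := rfl

theorem bind_dirac_setState {X : Type*} [TopologicalSpace X] (ν : Measure L) [IsFiniteMeasure ν]
    (φ : C(L, X)) {x : X} (hF : ν (φ ⁻¹' {x}) ≠ 0) (hmeas : MeasurableSet (φ ⁻¹' {x})) :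
    bind (dirac φ) (setState ν (φ ⁻¹' {x}) hF) = eval x := by
  ext f
  have h : ν.real (φ ⁻¹' {x}) ≠ 0 := by
    simpa [Measure.real, ENNReal.toReal_eq_zero_iff] using hF
  rw [bind_dirac_apply, setState_apply, setIntegral_congr_fun (f := fun y => (f.comp φ) y)
    (g := fun _ => f x) hmeas (fun y hy => congrArg f hy)]
  simp [h]

/-- An element of `βΓ` that moves the state of a set to a point mass at `z` witnesses that the
point mass at `θ z` is dominated by a multiple of the invariant measure `θ_* ν`. -/
theorem apply_le_mul_integral [T2Space L] (ν : Measure L) [IsFiniteMeasure ν] {F : Set L}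
    (hF : ν F ≠ 0) {θ : L → Z} (hθ : IsSpaceMap Γ θ) [SMulInvariantMeasure Γ Z (ν.map θ)]
    {U : Ultrafilter Γ} {z : L} (hz : ultraSMul U (setState ν F hF) = eval z) (g : C(Z, ℝ))
    (hg : ∀ y, 0 ≤ g y) : g (θ z) ≤ (ν.real F)⁻¹ * ∫ y, g y ∂(ν.map θ) := by
  let f : C(L, ℂ) := (ofRealC g).comp ⟨θ, hθ.continuous⟩
  have hlim : Tendsto (fun s : Γ => ((s • setState ν F hF) f).re) U (𝓝 (g (θ z))) := by
    have h := tendsto_ultraSMul U (setState ν F hF)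
    rw [hz] at h
    exact (Complex.continuous_re.tendsto _).comp (((continuous_apply f).tendsto _).comp h)
  refine le_of_tendsto hlim (Eventually.of_forall fun s => ?_)
  have hint : Integrable (fun y => g (s • θ y)) ν := by
    have := (integrable_continuousMap ν (translate s f)).re
    refine this.congr (Eventually.of_forall fun y => ?_)
    change g (θ (s • y)) = _
    rw [hθ.map_smul]
  have h1 : (s • setState ν F hF) f = (((ν.real F)⁻¹ * ∫ y in F, g (s • θ y) ∂ν : ℝ) : ℂ) := by
    rw [StateSpace.smul_apply, setState_apply, Complex.ofReal_mul, ← integral_complex_ofReal]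
    simp only [f, translate_apply, ContinuousMap.comp_apply, ContinuousMap.coe_mk, hθ.map_smul]
    rfl
  rw [h1, Complex.ofReal_re]
  refine mul_le_mul_of_nonneg_left ?_ (by positivity)
  calc ∫ y in F, g (s • θ y) ∂ν ≤ ∫ y, g (s • θ y) ∂ν :=
        setIntegral_le_integral hint (Eventually.of_forall fun y => hg _)
    _ = ∫ y, g (s • y) ∂(ν.map θ) := by
        rw [integral_map hθ.continuous.measurable.aemeasurable]
        exact (g.continuous.comp (continuous_const_smul s)).measurable.aestronglyMeasurable
    _ = ∫ y, g y ∂(ν.map θ) := integral_smul_eq_self (μ := ν.map θ) (fun y => g y) (g := s)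

/-- On an infinite minimal space, no point mass is dominated by a multiple of an invariant
probability measure: the points of the infinite orbit would all carry the same mass. -/
theorem not_forall_apply_le_mul_integral [CompactSpace Z] [T2Space Z] [MulAction.IsMinimal Γ Z]
    [Infinite Z] (μ : Measure Z) [IsProbabilityMeasure μ] [SMulInvariantMeasure Γ Z μ]
    (C : ℝ) (z : Z) :
    ¬ ∀ g : C(Z, ℝ), (∀ y, 0 ≤ g y) → g z ≤ C * ∫ y, g y ∂μ := by
  intro h
  have hC : 0 ≤ C := by
    have := h 1 fun _ => zero_le_one
    simp at this
    linarith
  have horb : (MulAction.orbit Γ z).Infinite := fun hfin => by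
    have := (MulAction.dense_orbit Γ z).closure_eq
    rw [hfin.isClosed.closure_eq] at this
    exact Set.infinite_univ (this ▸ hfin)
  have hopen : ∀ p ∈ MulAction.orbit Γ z, ∀ V : Set Z, IsOpen V → p ∈ V → 1 ≤ C * μ.real V := by
    rintro _ ⟨s, rfl⟩ V hV hp
    obtain ⟨f, hf0, hf1, hf⟩ := exists_continuous_zero_one_of_isClosed hV.isClosed_compl
      (isClosed_singleton (x := s • z)) (by simpa using hp)
    have h1 := h (f.comp ⟨fun y => s • y, continuous_const_smul s⟩) fun y => (hf _).1
    have h2 : f (s • z) = 1 := hf1 rfl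
    simp only [ContinuousMap.comp_apply, ContinuousMap.coe_mk, h2] at h1
    rw [integral_smul_eq_self (μ := μ) (fun y => f y) (g := s)] at h1
    refine h1.trans (mul_le_mul_of_nonneg_left ?_ hC)
    rw [← integral_indicator_one hV.measurableSet]
    refine integral_mono_of_nonneg (Eventually.of_forall fun y => (hf y).1)
      ((integrable_const 1).indicator hV.measurableSet) (Eventually.of_forall fun y => ?_)
    by_cases hy : y ∈ V
    · simpa [hy] using (hf y).2
    · simpa [hy] using (hf0 hy).le
  obtain ⟨N, hN⟩ := exists_nat_gt C
  obtain ⟨S, hS, hcard⟩ := horb.exists_subset_card_eq N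
  obtain ⟨V, hV, hdisj⟩ := S.finite_toSet.t2_separation
  have h1 : (N : ℝ) ≤ C * ∑ p ∈ S, μ.real (V p) := by
    rw [Finset.mul_sum, ← hcard, Finset.cast_card]
    exact Finset.sum_le_sum fun p hp => hopen p (hS hp) _ (hV p).2 (hV p).1
  have h2 : ∑ p ∈ S, μ.real (V p) ≤ 1 := by
    rw [← measureReal_biUnion_finset hdisj fun p _ => (hV p).2.measurableSet]
    exact measureReal_le_one
  have h3 := mul_le_mul_of_nonneg_left h2 hC
  linarith

end Measure

/-- Under a unital order isomorphism onto `C(Y)`, a positive element of norm `1` attains the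
value `1`. -/
theorem exists_apply_eq_one {Γ : Type*} [Group Γ] {A : Type*} [CStarAlgebra A] [PartialOrder A]
    [StarOrderedRing A] {I : GammaOperatorSystem Γ A} {Y : Type*} [TopologicalSpace Y]
    [CompactSpace Y] [Nonempty Y] [MulAction Γ Y] [ContinuousConstSMul Γ Y]
    {e : I.space ≃ₗ[ℂ] (continuousFunctions Γ Y).space}
    (he : IsGammaMap I (continuousFunctions Γ Y) e.toLinearMap)
    (he' : IsGammaMap (continuousFunctions Γ Y) I e.symm.toLinearMap) {w : I.space}
    (h0 : 0 ≤ (w : A)) (h1 : (w : A) ≤ 1) (hw : ‖(w : A)‖ = 1) :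
    ∃ y, (e w : C(Y, ℂ)) y = 1 := by
  have he0 : 0 ≤ (e w : C(Y, ℂ)) := he.ucp.nonneg h0
  have he1 : (e w : C(Y, ℂ)) ≤ 1 := by
    have h := he.ucp.mono (v := w) (w := ⟨1, I.one_mem⟩) h1
    rw [he.ucp.map_one] at h
    exact h
  have hre : ∀ y, (e w : C(Y, ℂ)) y = (((e w : C(Y, ℂ)) y).re : ℂ) := fun y =>
    Complex.ext rfl (Complex.le_def.1 (ContinuousMap.le_def.1 he0 y)).2.symm
  obtain ⟨y, -, hy⟩ := isCompact_univ.exists_isMaxOn Set.univ_nonempty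
    (Complex.continuous_re.comp (e w : C(Y, ℂ)).continuous).continuousOn
  refine ⟨y, ?_⟩
  set c : ℝ := ((e w : C(Y, ℂ)) y).re with hc
  have hc0 : 0 ≤ c := (Complex.le_def.1 (ContinuousMap.le_def.1 he0 y)).1
  have hc1 : c ≤ 1 := (Complex.le_def.1 (ContinuousMap.le_def.1 he1 y)).1
  have hle : (e w : C(Y, ℂ)) ≤ ((c : ℂ) • (1 : C(Y, ℂ)) : C(Y, ℂ)) :=
    ContinuousMap.le_def.2 fun z => by
      rw [hre z]
      simpa using hy (Set.mem_univ z)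
  have hle' : (w : A) ≤ algebraMap ℝ A c := by
    have h := he'.ucp.mono (v := e w) (w := (c : ℂ) • ⟨1, Submodule.mem_top⟩) hle
    rw [_root_.map_smul, he'.ucp.map_one] at h
    simpa [Algebra.algebraMap_eq_smul_one] using h
  have hnorm := (CStarAlgebra.norm_le_iff_le_algebraMap (w : A) hc0 h0).2 hle'
  rw [hw] at hnorm
  rw [hre y, ← hc, le_antisymm hc1 hnorm, Complex.ofReal_one]

end GammaBoundary

open GammaBoundary in
theorem mainTheorem7 {Γ : Type u} [Group Γ] [Countable Γ]
    -- `L` is the universal minimal `Γ`-space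
    {L : Type u} [TopologicalSpace L] [CompactSpace L] [T2Space L]
    [MulAction Γ L] [ContinuousConstSMul Γ L] [MeasurableSpace L] [BorelSpace L]
    (hL : GammaBoundary.IsUniversalMinimal Γ L)
    -- `X` is a minimal `Γ`-space
    {X : Type u} [TopologicalSpace X] [CompactSpace X] [T2Space X]
    [MulAction Γ X] [ContinuousConstSMul Γ X] [MulAction.IsMinimal Γ X]
    -- `Z` is an infinite minimal `Γ`-space with an invariant probability measure `μ`
    {Z : Type u} [TopologicalSpace Z] [CompactSpace Z] [T2Space Z]
    [MulAction Γ Z] [ContinuousConstSMul Γ Z] [MulAction.IsMinimal Γ Z] [Infinite Z]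
    [MeasurableSpace Z] [BorelSpace Z]
    (μ : MeasureTheory.Measure Z) [MeasureTheory.IsProbabilityMeasure μ]
    [MeasureTheory.SMulInvariantMeasure Γ Z μ]
    (φ : L → X) (hφ : GammaBoundary.IsSpaceMap Γ φ) (hφ_surj : Function.Surjective φ)
    (θ : L → Z) (hθ : GammaBoundary.IsSpaceMap Γ θ) (hθ_surj : Function.Surjective θ)
    -- `ν` is a pull back of `μ` under `θ` charging some fiber of `φ`
    (ν : MeasureTheory.Measure L) (hν : ν.map θ = μ)
    (x : X) (hx : ν (φ ⁻¹' {x}) ≠ 0)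
    -- `(I, κ)` is the `Γ`-injective envelope of `C(X)`
    {A : Type u} [CStarAlgebra A] [PartialOrder A] [StarOrderedRing A]
    (I : GammaBoundary.GammaOperatorSystem Γ A)
    (κ : (GammaBoundary.continuousFunctions Γ X).space →ₗ[ℂ] I.space)
    (hI : GammaBoundary.IsGammaInjectiveEnvelope (GammaBoundary.continuousFunctions Γ X) I κ) :
    ¬ GammaBoundary.IsIsomorphic I (GammaBoundary.continuousFunctions Γ L) := by
  rintro ⟨e, he, he'⟩
  subst hν
  have := hL.isMinimal
  obtain ⟨E, u, hE⟩ := hL.exists_retract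
  have : Nonempty L := ⟨u⟩
  have : MeasureTheory.IsFiniteMeasure ν := by
    constructor
    have h : (ν.map θ) Set.univ = 1 := MeasureTheory.measure_univ
    rw [MeasureTheory.Measure.map_apply hθ.continuous.measurable .univ, Set.preimage_univ] at h
    simp [h]
  obtain ⟨k, hk, hksys⟩ := (he.comp hI.extension.gammaMap).exists_kernel
  -- retractions of `C(L)` fixing the image of `C(X)` are conjugate to retractions of `I`
  have hid : ∀ P : C(L, StateSpace L), IsSpaceMap Γ P →
      (∀ y, StateSpace.bind P (P y) = P y) → (∀ y, StateSpace.bind k (P y) = k y) →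
      ∀ y, P y = StateSpace.eval y := by
    intro P hP hPP hPk y
    have hcompP : ∀ v, systemMap Γ P (systemMap Γ P v) = systemMap Γ P v :=
      LinearMap.congr_fun (congrArg (systemMap Γ)
        (ContinuousMap.ext hPP : StateSpace.kernelComp P P = P))
    have hcompk : ∀ v, systemMap Γ P (systemMap Γ k v) = systemMap Γ k v :=
      LinearMap.congr_fun (congrArg (systemMap Γ)
        (ContinuousMap.ext hPk : StateSpace.kernelComp k P = k))
    have hcompk' : ∀ v, systemMap Γ P (e (κ v)) = e (κ v) := by
      rw [hksys] at hcompk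
      exact hcompk
    have hfix := hI.eq_self_of_idempotent (he'.comp ((isGammaMap_systemMap hP).comp he))
      (fun v => by simp [hcompP]) (fun v => by simp [hcompk'])
    ext f
    have h1 := congrArg e (hfix (e.symm ⟨f, Submodule.mem_top⟩))
    simp only [LinearMap.comp_apply, LinearEquiv.coe_coe, LinearEquiv.apply_symm_apply] at h1
    exact congrArg (fun v : (continuousFunctions Γ L).space => (v : C(L, ℂ)) y) h1
  -- `κ` is isometric, and `e` carries norm `1` of a positive element to an attained value `1`
  have hattain : ∀ (x : X), ∃ p, k p = StateSpace.eval x := fun x =>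
    exists_eq_eval_of_attains k x fun f hf0 hf1 hfx => by
      let v : (continuousFunctions Γ X).space := ⟨f, Submodule.mem_top⟩
      have hκ1 : (κ v : A) ≤ 1 := by
        have h := hI.extension.gammaMap.ucp.mono (v := v) (w := ⟨1, Submodule.mem_top⟩) hf1
        rw [hI.extension.gammaMap.ucp.map_one] at h
        exact h
      have hnorm : ‖(κ v : A)‖ = 1 := by
        rw [hI.extension.isometric.norm_map]
        refine le_antisymm ((CStarAlgebra.norm_le_one_iff_of_nonneg f hf0).2 hf1) ?_
        simpa [hfx] using f.norm_coe_le_norm x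
      obtain ⟨y, hy⟩ := exists_apply_eq_one he he' (hI.extension.gammaMap.ucp.nonneg hf0) hκ1 hnorm
      refine ⟨y, ?_⟩
      rw [← hy]
      exact congrArg (fun w : (continuousFunctions Γ L).space => (w : C(L, ℂ)) y)
        (LinearMap.congr_fun hksys v)
  obtain ⟨U, z, hz⟩ := hE.exists_ultraSMul_eq_eval hk (hE.rigid hk hid) hattain
    (φ := ⟨φ, hφ.continuous⟩) hφ (bind_dirac_setState ν ⟨φ, hφ.continuous⟩ hx
      (isClosed_singleton.preimage hφ.continuous).measurableSet)
  exact not_forall_apply_le_mul_integral (Γ := Γ) (ν.map θ) _ (θ z)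
    (apply_le_mul_integral ν hx hθ hz)
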